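/- Let $X$ be a real Banach space with closed unit ball $B_X$ and continuous dual $X^*$, and let $A\colon X\rightrightarrows X^*$ be a set-valued operator with graph $\operatorname{gra}A=\{(x,x^*)\in X\times X^*: x^*\in Ax\}$ and domain $\operatorname{dom}A=\{x\in X: Ax\neq\varnothing\}$. For $C\subseteq X$ write $A(C)=\bigcup_{y\in C}Ay$, and let $\overline{D}^{\,w*}$ denote the weak$^*$ closure of $D\subseteq X^*$. Suppose that $A$ is maximally monotone, i.e. $\langle x-y,x^*-y^*\rangle\ge 0$ for all $(x,x^*),(y,y^*)\in\operatorname{gra}A$ and $\operatorname{gra}A$ is not properly contained in the graph of another operator with this property, and suppose that $\operatorname{int}\operatorname{dom}A\neq\varnothing$. (i) For every $x\in X$, $$Ax=\widehat{A}(x):=\bigcap_{\varepsilon>0}\overline{\operatorname{conv}\left[A(x+\varepsilon B_X)\right]}^{\,w*}.$$ In particular, $A$ has property (Q): for every net $(x_\alpha)_{\alpha\in J}$ in $X$ converging in norm to some $x\in X$, $$\bigcap_{\alpha\in J}\overline{\operatorname{conv}\Big[\bigcup_{\beta\succeq\alpha}A(x_\beta)\Big]}^{\,w*}\subseteq Ax;$$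 and $\operatorname{gra}A$ is closed in the norm $\times$ weak$^*$ topology of $X\times X^*$. (ii) Let $S\subseteq\operatorname{int}\operatorname{dom}A$ be dense in $\operatorname{int}\operatorname{dom}A$, and let $A_S\colon X\rightrightarrows X^*$ be the operator whose graph is the norm $\times$ weak$^*$ closure of $\operatorname{gra}A\cap(S\times X^*)$. Then for every $x\in X$, $$\widehat{A_S}(x):=\bigcap_{\varepsilon>0}\overline{\operatorname{conv}\left[A(S\cap(x+\varepsilon B_X))\right]}^{\,w*}\ \supseteq\ \overline{\operatorname{conv}\left[A_S(x)\right]}^{\,w*}$$ and $$Ax=\widehat{A_S}(x)+\operatorname{rec}A(x),$$ where $\operatorname{rec}A(x)$ is the set of all $x^*\in X^*$ for which there are real numbers $t_n>0$ with $t_n\to0$ and $(a_n,a_n^*)\in\operatorname{gra}A$ ($n\in\mathbb N$) such that $a_n\to x$ in norm and $t_na_n^*\to x^*$ in the weak$^*$ topology. -/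

import Mathlib

open scoped Pointwise Topology
open Filter Set

/-! Set-valued operators `A : X ⇉ X*` on a real Banach space `X`. The dual `X*` is realised as
`WeakDual ℝ X`: the continuous linear functionals on `X`, carrying the weak* topology. Every
topological notion used on `X*` below is a weak* one, and `X × WeakDual ℝ X` carries the
norm × weak* topology. -/

universe u w

namespace MonotoneOperator

variable {X : Type*} [NormedAddCommGroup X] [NormedSpace ℝ X]

/-- The graph of `A`. -/
def gra (A : X → Set (WeakDual ℝ X)) : Set (X × WeakDual ℝ X) :=
  {p | p.2 ∈ A p.1}

/-- The domain of `A`: the points with nonempty value. -/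
def dom (A : X → Set (WeakDual ℝ X)) : Set X :=
  {x | (A x).Nonempty}

/-- The image `A(C)`, the union of the `A x` with `x ∈ C`. -/
def image (A : X → Set (WeakDual ℝ X)) (C : Set X) : Set (WeakDual ℝ X) :=
  ⋃ x ∈ C, A x

/-- `A` is monotone. -/
def IsMonotone (A : X → Set (WeakDual ℝ X)) : Prop :=
  ∀ p ∈ gra A, ∀ q ∈ gra A, 0 ≤ (p.2 - q.2) (p.1 - q.1)

/-- `A` is monotone and has no proper monotone extension, in the sense of graph inclusion. -/
def IsMaximallyMonotone (A : X → Set (WeakDual ℝ X)) : Prop :=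
  IsMonotone A ∧
    ∀ B : X → Set (WeakDual ℝ X), IsMonotone B → gra A ⊆ gra B → gra B = gra A

/-- The weak* closed convex hull of a set of functionals. -/
def wstarClosedConvexHull (D : Set (WeakDual ℝ X)) : Set (WeakDual ℝ X) :=
  closure (convexHull ℝ D)

/-- `A_S`, the operator whose graph is the norm × weak* closure of `gra A ∩ (S × X*)`. -/
def closureOn (A : X → Set (WeakDual ℝ X)) (S : Set X) : X → Set (WeakDual ℝ X) :=
  fun x => {f | (x, f) ∈ closure (gra A ∩ S ×ˢ univ)}

/-- The operator `Â`: the intersection over `ε > 0` of the weak* closed convex hulls of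
`A(x + ε B_X)`, where `B_X` is the closed unit ball. -/
def hat (A : X → Set (WeakDual ℝ X)) : X → Set (WeakDual ℝ X) :=
  fun x => ⋂ (ε : ℝ) (_ : 0 < ε), wstarClosedConvexHull (image A (Metric.closedBall x ε))

/-- The operator `Â_S`: the intersection over `ε > 0` of the weak* closed convex hulls of
`A(S ∩ (x + ε B_X))`. -/
def hatOn (A : X → Set (WeakDual ℝ X)) (S : Set X) : X → Set (WeakDual ℝ X) :=
  fun x => ⋂ (ε : ℝ) (_ : 0 < ε), wstarClosedConvexHull (image A (S ∩ Metric.closedBall x ε))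

/-- Property (Q): for every net `u` in `X` (indexed by a nonempty directed preordered set `J`)
converging in norm to a point `x`, the intersection over `a ∈ J` of the weak* closed convex hulls
of `⋃ b ≥ a, A (u b)` is contained in `A x`. -/
def HasPropertyQ {X : Type u} [NormedAddCommGroup X] [NormedSpace ℝ X]
    (A : X → Set (WeakDual ℝ X)) : Prop :=
  ∀ (J : Type w) [Preorder J] [IsDirected J (· ≤ ·)] [Nonempty J] (u : J → X) (x : X),
    Tendsto u atTop (𝓝 x) →
      (⋂ a : J, wstarClosedConvexHull (⋃ (b : J) (_ : a ≤ b), A (u b))) ⊆ A x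

/-- The recession cone `rec A (x)`: the weak* limits of sequences `t n • f n`, where the `t n`
are positive and tend to `0`, `f n ∈ A (a n)`, and `a n` tends to `x` in norm. -/
def recCone (A : X → Set (WeakDual ℝ X)) (x : X) : Set (WeakDual ℝ X) :=
  {g | ∃ (t : ℕ → ℝ) (a : ℕ → X) (f : ℕ → WeakDual ℝ X),
    (∀ n, 0 < t n) ∧ Tendsto t atTop (𝓝 0) ∧
    (∀ n, (a n, f n) ∈ gra A) ∧ Tendsto a atTop (𝓝 x) ∧
    Tendsto (fun n => t n • f n) atTop (𝓝 g)}

end MonotoneOperator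

/-!
The argument has three ingredients.

*The interior of the domain.* Let `graHull A` be the convex hull of the points `(y, g, g y)` with
`(y, g)` in the graph. The function `v ↦ sup (g v - r) / (‖y‖ + 1)` over `(y, g, r) ∈ graHull A` is
convex, lower semicontinuous and finite on `dom A`, so by Baire's theorem it is bounded
above on some ball, and by convexity near every interior point of the domain. Conversely, a point
`x` near which it is bounded above lies in `dom A` (`IsMaximallyMonotone.mem_dom_of_ball`): a Hahn-Banach separation
produces an element of `A x`. Consequently `interior (dom A)` is convex and contains the half-open
segments towards points of `dom A`. The bound also gives the estimate
`δ ‖g‖ ≤ g (y - z) + K (‖y‖ + 1)` for `z` in the interior of the domain and `(y, g)` in the graph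
(`IsMonotone.exists_coercive`).

*The envelope.* By that estimate the error made in replacing `y` by a nearby `x` in the
monotonicity inequality is controlled by a small multiple of an affine function of the functional.
The resulting affine inequalities survive passage to weak* closed convex hulls, and letting the
radius tend to `0` gives `hat A x ⊆ A x`. Property (Q), closedness of the graph and `hatOn A S x ⊆ A x`
follow.

*The decomposition.* If `A x` is nonempty, `recCone A x` is the normal cone to `dom A` at `x`. The sum
of `hatOn A S x` and this cone is convex, and weak* closed because both summands are coercive in the
same direction. A point of `A x` outside the sum could be strictly separated from it by a direction
which, after a small tilt, points into the interior of the domain. Approaching `x` along that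
direction through `S`, the values of `A` stay bounded and have a cluster point in `hatOn A S x`, which
by monotonicity contradicts the separation.
-/

namespace MonotoneOperator

/-! ### Preliminaries on the weak* dual -/

variable {X : Type*} [NormedAddCommGroup X] [NormedSpace ℝ X] {A : X → Set (WeakDual ℝ X)}

theorem weakDual_add_apply (f g : WeakDual ℝ X) (v : X) : (f + g) v = f v + g v := rfl

theorem weakDual_sub_apply (f g : WeakDual ℝ X) (v : X) : (f - g) v = f v - g v := rfl

theorem weakDual_smul_apply (c : ℝ) (f : WeakDual ℝ X) (v : X) : (c • f) v = c * f v := rfl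

theorem norm_toStrongDual_le {g : WeakDual ℝ X} {η B : ℝ} (hη : 0 < η)
    (h : ∀ v, ‖v‖ ≤ η → g v ≤ B) : ‖WeakDual.toStrongDual g‖ ≤ B / η := by
  have hB : 0 ≤ B := by simpa using h 0 (by simpa using hη.le)
  refine (WeakDual.toStrongDual g).opNorm_le_bound (by positivity) fun w => ?_
  rcases eq_or_ne w 0 with rfl | hw
  · simp
  have hwn : 0 < ‖w‖ := norm_pos_iff.2 hw
  have hq : ‖(η / ‖w‖) • w‖ ≤ η := by
    rw [norm_smul, Real.norm_of_nonneg (by positivity), div_mul_cancel₀ _ hwn.ne']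
  have e1 := h _ hq
  have e2 := h (-((η / ‖w‖) • w)) (by rwa [norm_neg])
  rw [map_neg] at e2
  have e3 : |g ((η / ‖w‖) • w)| ≤ B := abs_le.2 ⟨by linarith, e1⟩
  rw [map_smul, smul_eq_mul, abs_mul, abs_of_pos (by positivity)] at e3
  change |g w| ≤ _
  rw [div_mul_eq_mul_div, le_div_iff₀ hη]
  rw [div_mul_eq_mul_div, div_le_iff₀ hwn] at e3
  linarith

/-! ### Maximality and the convexified graph -/

theorem IsMaximallyMonotone.mem_of_forall (hA : IsMaximallyMonotone A) {x : X}
    {f : WeakDual ℝ X} (h : ∀ y, ∀ g ∈ A y, g (x - y) ≤ f (x - y)) : f ∈ A x := by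
  have hB := hA.2 (fun y => {g | g ∈ A y ∨ (y = x ∧ g = f)}) ?_ (fun p hp => Or.inl hp)
  · have : (x, f) ∈ gra A := by
      rw [← hB]
      exact Or.inr ⟨rfl, rfl⟩
    exact this
  · rintro ⟨y, g⟩ (hp | ⟨hy, hg⟩) ⟨y', g'⟩ (hq | ⟨hy', hg'⟩)
    · exact hA.1 _ hp _ hq
    · simp only at hy' hg' ⊢
      subst hy' hg'
      have := h y g hp
      simp only [map_sub, weakDual_sub_apply] at this ⊢
      linarith
    · simp only at hy hg ⊢
      subst hy hg
      have := h y' g' hq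
      simp only [map_sub, weakDual_sub_apply] at this ⊢
      linarith
    · simp only at hy hg hy' hg' ⊢
      subst hy hg hy' hg'
      simp

theorem IsMonotone.apply_le (hA : IsMonotone A) {x y : X} {f g : WeakDual ℝ X}
    (hf : f ∈ A x) (hg : g ∈ A y) : g (x - y) ≤ f (x - y) := by
  have := hA (x, f) hf (y, g) hg
  simp only [weakDual_sub_apply] at this
  linarith

/-- The convex hull of the points `(y, g, g y)` with `(y, g)` in the graph of `A`. -/
def graHull (A : X → Set (WeakDual ℝ X)) : Set (X × WeakDual ℝ X × ℝ) :=
  convexHull ℝ ((fun p : X × WeakDual ℝ X => (p.1, p.2, p.2 p.1)) '' gra A)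

theorem mem_graHull {y : X} {g : WeakDual ℝ X} (hg : g ∈ A y) : (y, g, g y) ∈ graHull A :=
  subset_convexHull ℝ _ ⟨(y, g), hg, rfl⟩

theorem graHull_induction {P : X × WeakDual ℝ X × ℝ → Prop} (hP : Convex ℝ {c | P c})
    (h : ∀ y, ∀ g ∈ A y, P (y, g, g y)) : ∀ c ∈ graHull A, P c :=
  convexHull_min (s := (fun p : X × WeakDual ℝ X => (p.1, p.2, p.2 p.1)) '' gra A)
    (t := {c | P c}) (by rintro _ ⟨p, hp, rfl⟩; exact h p.1 p.2 hp) hP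

theorem IsMonotone.graHull_pairing (hA : IsMonotone A) {a : X} {f : WeakDual ℝ X} (hf : f ∈ A a) :
    ∀ c ∈ graHull A, c.2.1 a + f c.1 ≤ c.2.2 + f a := by
  refine graHull_induction ?_ ?_
  · rintro ⟨y, g, r⟩ h ⟨y', g', r'⟩ h' s t hs ht hst
    simp only [mem_ofPred_eq] at h h'
    simp only [mem_ofPred_eq, Prod.smul_mk, Prod.mk_add_mk, map_add, map_smul, smul_eq_mul,
      weakDual_add_apply, weakDual_smul_apply]
    obtain rfl : t = 1 - s := by linarith
    nlinarith [mul_le_mul_of_nonneg_left h hs, mul_le_mul_of_nonneg_left h' ht]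
  · intro y g hg
    have := hA.apply_le hf hg
    simp only [map_sub] at this
    simp only
    linarith

/-- The third coordinate dominates the duality pairing on `graHull A`. Although the pairing is not
convex, this follows from monotonicity by averaging twice: once over each of the two points
compared. -/
theorem IsMonotone.apply_le_of_mem_graHull (hA : IsMonotone A) :
    ∀ c ∈ graHull A, c.2.1 c.1 ≤ c.2.2 := by
  intro c hc
  have key : ∀ d ∈ graHull A, c.2.1 d.1 + d.2.1 c.1 ≤ c.2.2 + d.2.2 := by
    refine graHull_induction ?_ ?_
    · rintro ⟨y, g, r⟩ h ⟨y', g', r'⟩ h' s t hs ht hst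
      simp only [mem_ofPred_eq] at h h'
      simp only [mem_ofPred_eq, Prod.smul_mk, Prod.mk_add_mk, map_add, map_smul, smul_eq_mul,
        weakDual_add_apply, weakDual_smul_apply]
      obtain rfl : t = 1 - s := by linarith
      nlinarith [mul_le_mul_of_nonneg_left h hs, mul_le_mul_of_nonneg_left h' ht]
    · intro y g hg
      exact hA.graHull_pairing hg c hc
  have := key c hc
  linarith

/-- If `r - g x ≥ -M ‖y - x‖` on the convexified graph, then `x` is in the domain: the set of points
`(y - x, r - g x)` is separated by a hyperplane from the cone `s < -M ‖w‖`, and that hyperplane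
is parallel to the kernel of `(w, s) ↦ s - f w` for a functional `f`, which is then monotonically
related to the graph at `x`. -/
theorem IsMaximallyMonotone.mem_dom_of_graHull (hA : IsMaximallyMonotone A) {x : X} {M : ℝ}
    (hM : 0 ≤ M) (hne : (graHull A).Nonempty)
    (h : ∀ c ∈ graHull A, c.2.1 x - M * ‖c.1 - x‖ ≤ c.2.2) : x ∈ dom A := by
  set s : Set (X × ℝ) := {p | p.2 < -(M * ‖p.1‖)} with hs
  set t : Set (X × ℝ) := (fun c : X × WeakDual ℝ X × ℝ => (c.1 - x, c.2.2 - c.2.1 x)) '' graHull A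
    with ht
  have hso : IsOpen s := isOpen_lt (by fun_prop) (by fun_prop)
  have hsc : Convex ℝ s := by
    rintro ⟨w, p⟩ h1 ⟨w', p'⟩ h2 a b ha hb hab
    simp only [hs, mem_ofPred_eq] at h1 h2
    simp only [hs, mem_ofPred_eq, Prod.smul_mk, Prod.mk_add_mk, smul_eq_mul]
    have h3 : ‖a • w + b • w'‖ ≤ a * ‖w‖ + b * ‖w'‖ := by
      refine (norm_add_le _ _).trans_eq ?_
      rw [norm_smul, norm_smul, Real.norm_of_nonneg ha, Real.norm_of_nonneg hb]
    have h4 := mul_le_mul_of_nonneg_left h3 hM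
    rcases ha.eq_or_lt with rfl | ha'
    · obtain rfl : b = 1 := by linarith
      linarith
    · nlinarith [mul_lt_mul_of_pos_left h1 ha', mul_le_mul_of_nonneg_left h2.le hb]
  have htc : Convex ℝ t := by
    rintro _ ⟨c, hc, rfl⟩ _ ⟨d, hd, rfl⟩ a b ha hb hab
    refine ⟨a • c + b • d, convex_convexHull ℝ _ hc hd ha hb hab, ?_⟩
    obtain rfl : b = 1 - a := by linarith
    ext
    · simp only [Prod.fst_add, Prod.smul_fst, Prod.smul_mk, Prod.mk_add_mk]
      module
    · simp only [Prod.snd_add, Prod.fst_add, Prod.smul_snd, Prod.smul_fst, smul_eq_mul,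
        weakDual_add_apply, weakDual_smul_apply]
      ring
  have hdisj : Disjoint s t := by
    rw [Set.disjoint_left]
    rintro _ hp ⟨c, hc, rfl⟩
    have := h c hc
    simp only [hs, mem_ofPred_eq] at hp
    linarith
  obtain ⟨φ, v, h1, h2⟩ := geometric_hahn_banach_open hsc hso htc hdisj
  set l : X →L[ℝ] ℝ := φ.comp (ContinuousLinearMap.inl ℝ X ℝ) with hl
  set c : ℝ := φ (0, 1) with hc
  have hφ : ∀ w r, φ (w, r) = l w + r * c := by
    intro w r
    have : ((w, r) : X × ℝ) = (w, 0) + r • (0, 1) := by simp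
    rw [this, map_add, map_smul]
    rfl
  have hneg : ∀ r > 0, -(r * c) < v := by
    intro r hr
    have := h1 (0, -r) (by simp [hs, hr])
    rw [hφ] at this
    simpa using this
  have hv : 0 ≤ v := by
    by_contra! hv
    have h3 := hneg (-v / (2 * (|c| + 1))) (div_pos (by linarith) (by positivity))
    have h4 : -v / (2 * (|c| + 1)) * c ≤ -v / 2 := by
      have : c ≤ |c| + 1 := by linarith [le_abs_self c]
      calc -v / (2 * (|c| + 1)) * c ≤ -v / (2 * (|c| + 1)) * (|c| + 1) := by
            refine mul_le_mul_of_nonneg_left this ?_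
            have : 0 < -v := by linarith
            positivity
        _ = -v / 2 := by
            have : |c| + 1 ≠ 0 := by positivity
            field_simp
    linarith
  have hc0 : 0 ≤ c := by
    by_contra! hc0
    have := hneg ((v + 1) / (-c)) (div_pos (by linarith) (by linarith))
    have hcc : c ≠ 0 := hc0.ne
    have h5 : (v + 1) / (-c) * c = -(v + 1) := by field_simp
    linarith
  have hcpos : 0 < c := by
    refine hc0.lt_of_ne fun hc0 => ?_
    -- a vertical hyperplane would be bounded above on the whole of `X`
    have hlv : ∀ w, l w < v := by
      intro w
      have := h1 (w, -(M * ‖w‖) - 1) (by simp [hs])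
      rw [hφ, ← hc0] at this
      simpa using this
    have hl0 : ∀ w, l w ≤ 0 := by
      intro w
      by_contra! hw
      have := hlv (((v + 1) / l w) • w)
      rw [map_smul, smul_eq_mul, div_mul_cancel₀ _ hw.ne'] at this
      linarith
    have hl0' : ∀ w, l w = 0 := fun w => le_antisymm (hl0 w) (by
      have := hl0 (-w)
      rw [map_neg] at this
      linarith)
    obtain ⟨d, hd⟩ := hne
    have h3 := h2 _ ⟨d, hd, rfl⟩
    have h4 := hlv 0
    rw [hφ, hl0', ← hc0] at h3
    rw [hl0'] at h4
    linarith
  refine ⟨StrongDual.toWeakDual (-(c⁻¹ • l)), hA.mem_of_forall fun y g hg => ?_⟩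
  have h3 := h2 _ ⟨_, mem_graHull hg, rfl⟩
  simp only at h3
  rw [hφ] at h3
  have h4 : 0 ≤ c⁻¹ * (l (y - x) + (g y - g x) * c) :=
    mul_nonneg (by positivity) (hv.trans h3)
  have h5 : c⁻¹ * (l (y - x) + (g y - g x) * c) = c⁻¹ * l (y - x) + (g y - g x) := by
    field_simp
  simp only [StrongDual.toWeakDual_apply, neg_apply,
    smul_apply, smul_eq_mul, map_sub] at h4 h5 ⊢
  linarith

/-! ### The interior of the domain -/

/-- The sublevel set at height `K` of the lower semicontinuous convex function
`v ↦ sup {(g v - r) / (‖y‖ + 1) | (y, g, r) ∈ graHull A}`. -/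
def level (A : X → Set (WeakDual ℝ X)) (K : ℝ) : Set X :=
  {v | ∀ c ∈ graHull A, c.2.1 v ≤ c.2.2 + K * (‖c.1‖ + 1)}

theorem isClosed_level (A : X → Set (WeakDual ℝ X)) (K : ℝ) : IsClosed (level A K) := by
  have : level A K = ⋂ c ∈ graHull A, {v : X | c.2.1 v ≤ c.2.2 + K * (‖c.1‖ + 1)} := by
    ext v
    simp [level]
  rw [this]
  exact isClosed_biInter fun c _ => isClosed_le c.2.1.continuous continuous_const

theorem level_mono {K L : ℝ} (h : K ≤ L) : level A K ⊆ level A L := by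
  intro v hv c hc
  have := hv c hc
  have : K * (‖c.1‖ + 1) ≤ L * (‖c.1‖ + 1) := by gcongr
  linarith

theorem level_combo {K L s t : ℝ} {v w : X} (hv : v ∈ level A K) (hw : w ∈ level A L)
    (hs : 0 ≤ s) (ht : 0 ≤ t) (hst : s + t = 1) : s • v + t • w ∈ level A (s * K + t * L) := by
  intro c hc
  have h1 := mul_le_mul_of_nonneg_left (hv c hc) hs
  have h2 := mul_le_mul_of_nonneg_left (hw c hc) ht
  obtain rfl : t = 1 - s := by linarith
  simp only [map_add, map_smul, smul_eq_mul]
  nlinarith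

theorem IsMonotone.mem_level (hA : IsMonotone A) {v : X} (hv : v ∈ dom A) :
    ∃ K, v ∈ level A K := by
  obtain ⟨f, hf⟩ := hv
  set F := WeakDual.toStrongDual f
  refine ⟨‖F‖ + |f v|, fun c hc => ?_⟩
  have h1 := hA.graHull_pairing hf c hc
  have h2 : -f c.1 ≤ ‖F‖ * ‖c.1‖ := (neg_le_abs _).trans (F.le_opNorm c.1)
  have h3 : f v ≤ |f v| := le_abs_self _
  have h4 : 0 ≤ |f v| * ‖c.1‖ := by positivity
  have h5 : 0 ≤ ‖F‖ := norm_nonneg _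
  nlinarith

/-- A Baire category argument: the domain is covered by countably many closed level sets. -/
theorem IsMonotone.exists_ball_subset_level [CompleteSpace X] (hA : IsMonotone A)
    (hint : (interior (dom A)).Nonempty) :
    ∃ z K, ∃ δ > 0, Metric.ball z δ ⊆ level A K := by
  have hd : Dense (⋃ n : ℕ, interior (level A n ∪ (interior (dom A))ᶜ)) := by
    refine dense_iUnion_interior_of_closed
      (fun n => (isClosed_level A n).union isOpen_interior.isClosed_compl) ?_
    refine eq_univ_of_forall fun v => mem_iUnion.2 ?_
    by_cases hv : v ∈ interior (dom A)
    · obtain ⟨K, hK⟩ := hA.mem_level (interior_subset hv)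
      obtain ⟨n, hn⟩ := exists_nat_ge K
      exact ⟨n, Or.inl (level_mono hn hK)⟩
    · exact ⟨0, Or.inr hv⟩
  obtain ⟨z, hz, hzU⟩ := hd.exists_mem_open isOpen_interior hint
  obtain ⟨n, hn⟩ := mem_iUnion.1 hz
  obtain ⟨δ, hδ, h⟩ := Metric.isOpen_iff.1 (isOpen_interior.inter isOpen_interior) z ⟨hn, hzU⟩
  refine ⟨z, n, δ, hδ, fun v hv => ?_⟩
  obtain ⟨h1, h2⟩ := h hv
  exact (interior_subset h1).resolve_right fun h3 => h3 h2

/-- If one end of a segment has a ball around it in a level set and the other end lies in some level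
set, then every point of the segment other than the second end has a ball around it in a level
set. -/
theorem exists_ball_subset_level_of_segment {z v : X} {K L δ t : ℝ} (hδ : 0 < δ)
    (hz : Metric.ball z δ ⊆ level A K) (hv : v ∈ level A L) (ht : 0 < t) (ht1 : t ≤ 1) :
    ∃ M, ∃ η > 0, Metric.ball ((1 - t) • v + t • z) η ⊆ level A M := by
  refine ⟨(1 - t) * L + t * K, t * δ, by positivity, fun w hw => ?_⟩
  have hmem : z + t⁻¹ • (w - ((1 - t) • v + t • z)) ∈ Metric.ball z δ := by
    rw [mem_ball_iff_norm] at hw ⊢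
    rw [add_sub_cancel_left, norm_smul, norm_inv, Real.norm_of_nonneg ht.le,
      inv_mul_lt_iff₀ ht]
    exact hw
  have := level_combo hv (hz hmem) (by linarith : 0 ≤ 1 - t) ht.le (by ring)
  convert this using 1
  rw [smul_add, smul_inv_smul₀ ht.ne']
  abel

/-- The ball in the level set bounds `r - g x` on the convexified graph below by `η ‖g‖` minus a
multiple of `‖y - x‖ + 1`. Where `η ‖g‖` dominates, `r - g x` is nonnegative up to a multiple of `‖y - x‖`;
elsewhere `‖g‖` is bounded, and `g y ≤ r` gives the bound. Hence `x` is in the domain. -/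
theorem IsMaximallyMonotone.mem_dom_of_ball (hA : IsMaximallyMonotone A)
    (hne : (dom A).Nonempty) {x : X} {K δ : ℝ} (hδ : 0 < δ)
    (h : Metric.ball x δ ⊆ level A K) : x ∈ dom A := by
  obtain ⟨K, hK0, h⟩ : ∃ K', 0 ≤ K' ∧ Metric.ball x δ ⊆ level A K' :=
    ⟨max K 0, le_max_right _ _, h.trans (level_mono (le_max_left _ _))⟩
  obtain ⟨y, g, hg⟩ := hne
  set R := K * (‖x‖ + 1) with hR
  have hR0 : 0 ≤ R := by positivity
  have hKR : K ≤ R := by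
    have : 0 ≤ K * ‖x‖ := by positivity
    linarith
  set η := δ / 2
  have hη : 0 < η := by positivity
  refine hA.mem_dom_of_graHull (M := 2 * R + 2 * R / η) (by positivity) ⟨_, mem_graHull hg⟩
    fun c hc => ?_
  set d := ‖c.1 - x‖ with hd
  set G := WeakDual.toStrongDual c.2.1 with hG
  have hd0 : 0 ≤ d := norm_nonneg _
  have hcn : K * (‖c.1‖ + 1) ≤ R * (d + 1) := by
    have : ‖c.1‖ ≤ ‖c.1 - x‖ + ‖x‖ := by simpa using norm_add_le (c.1 - x) x
    have := mul_le_mul_of_nonneg_left this hK0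
    nlinarith [mul_le_mul_of_nonneg_right hKR hd0]
  have h1 : c.2.1 x + η * ‖G‖ ≤ c.2.2 + R * (d + 1) := by
    have hb : ‖G‖ ≤ (c.2.2 + R * (d + 1) - c.2.1 x) / η := by
      refine norm_toStrongDual_le hη fun w hw => ?_
      have := h (show x + w ∈ Metric.ball x δ by
        rw [mem_ball_iff_norm, add_sub_cancel_left]
        exact hw.trans_lt (half_lt_self hδ)) c hc
      rw [map_add] at this
      linarith
    rw [le_div_iff₀ hη] at hb
    linarith
  have h2 : c.2.1 x - ‖G‖ * d ≤ c.2.2 := by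
    have e1 := hA.1.apply_le_of_mem_graHull c hc
    have e2 : -c.2.1 (c.1 - x) ≤ ‖G‖ * d := (neg_le_abs _).trans (G.le_opNorm _)
    rw [map_sub] at e2
    linarith
  have hRη : 0 ≤ 2 * R / η := by positivity
  rcases le_total d 1 with hd1 | hd1
  · rcases le_total (R * (d + 1)) (η * ‖G‖) with h3 | h3
    · have : 0 ≤ (2 * R + 2 * R / η) * d := by positivity
      linarith
    · have h4 : ‖G‖ ≤ 2 * R / η := by
        rw [le_div_iff₀ hη]
        nlinarith
      have := mul_le_mul_of_nonneg_right h4 hd0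
      nlinarith
  · have h5 : 0 ≤ η * ‖G‖ := by positivity
    have h6 : 0 ≤ 2 * R / η * d := by positivity
    nlinarith

theorem IsMaximallyMonotone.mem_interior_dom_of_ball (hA : IsMaximallyMonotone A)
    (hne : (dom A).Nonempty) {x : X} {K δ : ℝ} (hδ : 0 < δ)
    (h : Metric.ball x δ ⊆ level A K) : x ∈ interior (dom A) := by
  refine mem_interior.2 ⟨Metric.ball x δ, fun y hy => ?_, Metric.isOpen_ball,
    Metric.mem_ball_self hδ⟩
  obtain ⟨η, hη, h'⟩ := Metric.isOpen_iff.1 Metric.isOpen_ball y hy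
  exact hA.mem_dom_of_ball hne hη (h'.trans h)

theorem IsMonotone.exists_ball_subset_level_of_mem [CompleteSpace X] (hA : IsMonotone A)
    {x : X} (hx : x ∈ interior (dom A)) :
    ∃ K, ∃ δ > 0, Metric.ball x δ ⊆ level A K := by
  obtain ⟨z, K, δ, hδ, hz⟩ := hA.exists_ball_subset_level ⟨x, hx⟩
  -- `x` lies strictly between `z` and a further point `x + s • (x - z)` of the domain
  have hev : ∀ᶠ s : ℝ in 𝓝 0, x + s • (x - z) ∈ dom A := by
    have : Tendsto (fun s : ℝ => x + s • (x - z)) (𝓝 0) (𝓝 x) := by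
      have : Continuous fun s : ℝ => x + s • (x - z) := by fun_prop
      simpa using this.tendsto 0
    exact this.eventually (mem_interior_iff_mem_nhds.1 hx)
  obtain ⟨ε, hε, hs⟩ := Metric.eventually_nhds_iff.1 hev
  have hs' : x + (ε / 2) • (x - z) ∈ dom A := hs (by
    rw [Real.dist_eq, sub_zero, abs_of_pos (by positivity)]
    linarith)
  obtain ⟨L, hL⟩ := hA.mem_level hs'
  have hpos : 0 < 1 + ε / 2 := by positivity
  obtain ⟨M, η, hη, hM⟩ := exists_ball_subset_level_of_segment
    (t := (ε / 2) / (1 + ε / 2)) hδ hz hL (by positivity)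
    ((div_le_one hpos).2 (by linarith))
  refine ⟨M, η, hη, ?_⟩
  convert hM using 2
  have e : 1 - (ε / 2) / (1 + ε / 2) = 1 / (1 + ε / 2) := by field_simp; ring
  rw [e]
  match_scalars <;> field_simp
  ring

/-- The interior of the domain contains the half-open segments from its points to points of the
domain. -/
theorem IsMaximallyMonotone.segment_subset_interior_dom [CompleteSpace X]
    (hA : IsMaximallyMonotone A) {z v : X} (hz : z ∈ interior (dom A)) (hv : v ∈ dom A) {t : ℝ}
    (ht : 0 < t) (ht1 : t ≤ 1) : (1 - t) • v + t • z ∈ interior (dom A) := by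
  obtain ⟨K, δ, hδ, h⟩ := hA.1.exists_ball_subset_level_of_mem hz
  obtain ⟨L, hL⟩ := hA.1.mem_level hv
  obtain ⟨M, η, hη, hM⟩ := exists_ball_subset_level_of_segment hδ h hL ht ht1
  exact hA.mem_interior_dom_of_ball ⟨v, hv⟩ hη hM

theorem IsMaximallyMonotone.convex_interior_dom [CompleteSpace X]
    (hA : IsMaximallyMonotone A) : Convex ℝ (interior (dom A)) := by
  intro x hx y hy s t hs ht hst
  rcases ht.eq_or_lt with rfl | ht
  · obtain rfl : s = 1 := by linarith
    simpa using hx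
  · obtain rfl : s = 1 - t := by linarith
    exact hA.segment_subset_interior_dom hy (interior_subset hx) ht (by linarith)

/-- A monotone operator is controlled by its growth away from an interior point of its domain. -/
theorem IsMonotone.exists_coercive [CompleteSpace X] (hA : IsMonotone A)
    {z : X} (hz : z ∈ interior (dom A)) :
    ∃ δ > 0, ∃ K, 0 ≤ K ∧ ∀ y, ∀ g ∈ A y, ∀ v, ‖v‖ ≤ δ → g v ≤ g (y - z) + K * (‖y‖ + 1) := by
  obtain ⟨K, δ, hδ, h⟩ := hA.exists_ball_subset_level_of_mem hz
  refine ⟨δ / 2, by positivity, max K 0, le_max_right _ _, fun y g hg v hv => ?_⟩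
  have := level_mono (le_max_left K 0) (h (show z + v ∈ Metric.ball z δ by
    rw [mem_ball_iff_norm, add_sub_cancel_left]
    linarith)) _ (mem_graHull hg)
  simp only [map_add, map_sub] at this ⊢
  linarith

/-! ### The closed convex envelope of the operator -/

theorem le_apply_of_mem_wstarClosedConvexHull {D : Set (WeakDual ℝ X)} {v : X} {c : ℝ}
    (h : ∀ f ∈ D, c ≤ f v) {f : WeakDual ℝ X} (hf : f ∈ wstarClosedConvexHull D) : c ≤ f v := by
  have hc : Convex ℝ {f : WeakDual ℝ X | c ≤ f v} := by
    intro f hf g hg s t hs ht hst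
    simp only [mem_ofPred_eq] at hf hg ⊢
    obtain rfl : t = 1 - s := by linarith
    simp only [weakDual_add_apply, weakDual_smul_apply]
    nlinarith [mul_le_mul_of_nonneg_left hf hs, mul_le_mul_of_nonneg_left hg ht]
  exact closure_minimal (convexHull_min h hc)
    (isClosed_le continuous_const (WeakDual.eval_continuous v)) hf

theorem wstarClosedConvexHull_mono {D E : Set (WeakDual ℝ X)} (h : D ⊆ E) :
    wstarClosedConvexHull D ⊆ wstarClosedConvexHull E :=
  closure_mono (convexHull_mono h)

theorem subset_wstarClosedConvexHull (D : Set (WeakDual ℝ X)) : D ⊆ wstarClosedConvexHull D :=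
  (subset_convexHull ℝ D).trans subset_closure

theorem convex_wstarClosedConvexHull (D : Set (WeakDual ℝ X)) :
    Convex ℝ (wstarClosedConvexHull D) :=
  (convex_convexHull ℝ D).closure

theorem mem_image {C : Set X} {x : X} (hx : x ∈ C) {f : WeakDual ℝ X} (hf : f ∈ A x) :
    f ∈ image A C :=
  mem_biUnion hx hf

theorem image_mono {C D : Set X} (h : C ⊆ D) : image A C ⊆ image A D :=
  biUnion_subset_biUnion_left h

theorem subset_hat (x : X) : A x ⊆ hat A x := fun _ hf =>
  mem_iInter₂.2 fun _ hε => subset_wstarClosedConvexHull _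
    (mem_image (Metric.mem_closedBall_self hε.le) hf)

theorem hatOn_subset_hat (S : Set X) (x : X) : hatOn A S x ⊆ hat A x :=
  iInter₂_mono fun _ _ => wstarClosedConvexHull_mono (image_mono inter_subset_right)

theorem isClosed_hatOn (S : Set X) (x : X) : IsClosed (hatOn A S x) :=
  isClosed_biInter fun _ _ => isClosed_closure

theorem convex_hatOn (S : Set X) (x : X) : Convex ℝ (hatOn A S x) :=
  convex_iInter₂ fun _ _ => convex_wstarClosedConvexHull _

/-- Near `x`, monotonicity against a fixed graph point `(y, g)` is, up to an error of order `κ`,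
an affine inequality in the functional alone, because the coercivity estimate bounds the
functional itself by an affine expression. Such inequalities pass to the closed convex hull. -/
theorem IsMaximallyMonotone.hat_subset [CompleteSpace X] (hA : IsMaximallyMonotone A)
    (hint : (interior (dom A)).Nonempty) (x : X) : hat A x ⊆ A x := by
  intro f hf
  refine hA.mem_of_forall fun y g hg => ?_
  obtain ⟨z, hz⟩ := hint
  obtain ⟨δ, hδ, K, hK, hco⟩ := hA.1.exists_coercive hz
  set C := K * (‖x‖ + δ + 1) with hC
  set G := WeakDual.toStrongDual g with hG
  have key : ∀ κ > 0, g (x - y) ≤ f (x - y) + κ * (f (x - z) + C + δ * ‖G‖) := by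
    intro κ hκ
    set ε := δ * κ / (1 + κ) with hε
    have hεδ : ε ≤ δ := by
      rw [hε, div_le_iff₀ (by positivity)]
      nlinarith
    have hεκ : ε ≤ δ * κ := div_le_self (by positivity) (by linarith)
    have haff : ∀ h ∈ image A (Metric.closedBall x ε),
        g (x - y) - κ * (C + δ * ‖G‖) ≤ h ((x - y) + κ • (x - z)) := by
      intro h hh
      obtain ⟨a, ha, hh⟩ := mem_iUnion₂.1 hh
      obtain ⟨w, rfl⟩ : ∃ w, a = x + w := ⟨a - x, by abel⟩
      rw [mem_closedBall_iff_norm, add_sub_cancel_left] at ha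
      have hv : ‖((1 + κ) / κ) • w‖ ≤ δ := by
        rw [norm_smul, Real.norm_of_nonneg (by positivity)]
        calc (1 + κ) / κ * ‖w‖ ≤ (1 + κ) / κ * ε := by gcongr
          _ = δ := by rw [hε]; field_simp
      have h1 := hco _ h hh _ hv
      have h2 : K * (‖x + w‖ + 1) ≤ C := by
        have : ‖x + w‖ ≤ ‖x‖ + δ := (norm_add_le _ _).trans (by linarith)
        rw [hC]
        gcongr
      have h3 := hA.1.apply_le hh hg
      have h4 : -g w ≤ ‖G‖ * ‖w‖ := (neg_le_abs _).trans (G.le_opNorm w)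
      have h5 : ‖G‖ * ‖w‖ ≤ ‖G‖ * (δ * κ) := by gcongr; linarith
      rw [map_smul, smul_eq_mul, div_mul_eq_mul_div, div_le_iff₀ hκ] at h1
      simp only [map_add, map_sub, map_smul, smul_eq_mul] at h1 h3 ⊢
      have h6 := mul_le_mul_of_nonneg_right h2 hκ.le
      nlinarith
    have h1 := le_apply_of_mem_wstarClosedConvexHull haff
      (mem_iInter₂.1 hf ε (by positivity))
    rw [map_add, map_smul, smul_eq_mul] at h1
    linarith
  set D := f (x - z) + C + δ * ‖G‖
  refine le_of_forall_pos_le_add fun η hη => (key (η / (|D| + 1)) (by positivity)).trans ?_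
  have : η / (|D| + 1) * D ≤ η := by
    rw [div_mul_eq_mul_div, div_le_iff₀ (by positivity)]
    gcongr
    linarith [le_abs_self D]
  linarith

theorem IsMaximallyMonotone.hat_eq [CompleteSpace X] (hA : IsMaximallyMonotone A)
    (hint : (interior (dom A)).Nonempty) : hat A = A :=
  funext fun x => (hA.hat_subset hint x).antisymm (subset_hat x)

theorem hasPropertyQ_of_hat_subset {X : Type u} [NormedAddCommGroup X] [NormedSpace ℝ X]
    {A : X → Set (WeakDual ℝ X)} (h : ∀ x, hat A x ⊆ A x) : HasPropertyQ.{u, w} A := by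
  intro J _ _ _ v x hv
  refine Subset.trans (fun f hf => ?_) (h x)
  refine mem_iInter₂.2 fun ε hε => ?_
  obtain ⟨a, ha⟩ := eventually_atTop.1 (hv.eventually (Metric.closedBall_mem_nhds x hε))
  refine wstarClosedConvexHull_mono (iUnion₂_subset fun b hb => ?_) (mem_iInter.1 hf a)
  exact fun g hg => mem_image (C := Metric.closedBall x ε) (ha b hb) hg

theorem wstarClosedConvexHull_closureOn_subset (S : Set X) (x : X) :
    wstarClosedConvexHull (closureOn A S x) ⊆ hatOn A S x := by
  refine closure_minimal (convexHull_min (fun f hf => ?_) (convex_hatOn S x)) (isClosed_hatOn S x)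
  refine mem_iInter₂.2 fun ε hε => closure_mono (subset_convexHull ℝ _) ?_
  rw [mem_closure_iff_nhds]
  intro V hV
  obtain ⟨⟨y, g⟩, hyV, hg, hyS⟩ := mem_closure_iff_nhds.1 (show (x, f) ∈ closure _ from hf) _
    (prod_mem_nhds (Metric.closedBall_mem_nhds x hε) hV)
  exact ⟨g, hyV.2, mem_image (C := S ∩ Metric.closedBall x ε) ⟨hyS.1, hyV.1⟩ hg⟩

theorem isClosed_gra_of_hat_subset (h : ∀ x, hat A x ⊆ A x) : IsClosed (gra A) := by
  refine closure_subset_iff_isClosed.1 ?_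
  rintro ⟨x, f⟩ hf
  refine h x (hatOn_subset_hat univ x (wstarClosedConvexHull_closureOn_subset univ x
    (subset_wstarClosedConvexHull _ ?_)))
  simpa [closureOn] using hf

/-! ### The recession cone -/

/-- The normal cone at `x` to the domain of `A`. -/
def domNormalCone (A : X → Set (WeakDual ℝ X)) (x : X) : Set (WeakDual ℝ X) :=
  {g | ∀ y ∈ dom A, 0 ≤ g (x - y)}

theorem isClosed_domNormalCone (x : X) : IsClosed (domNormalCone A x) := by
  have : domNormalCone A x = ⋂ y ∈ dom A, {g : WeakDual ℝ X | 0 ≤ g (x - y)} := by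
    ext g
    simp [domNormalCone]
  rw [this]
  exact isClosed_biInter fun y _ =>
    isClosed_le continuous_const (WeakDual.eval_continuous (x - y))

theorem convex_domNormalCone (x : X) : Convex ℝ (domNormalCone A x) := by
  intro f hf g hg s t hs ht _ y hy
  have h1 := mul_nonneg hs (hf y hy)
  have h2 := mul_nonneg ht (hg y hy)
  simp only [weakDual_add_apply, weakDual_smul_apply]
  linarith

theorem smul_mem_domNormalCone {x : X} {g : WeakDual ℝ X} (hg : g ∈ domNormalCone A x) {c : ℝ}
    (hc : 0 ≤ c) : c • g ∈ domNormalCone A x := fun y hy => by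
  rw [weakDual_smul_apply]
  exact mul_nonneg hc (hg y hy)

theorem IsMaximallyMonotone.add_mem (hA : IsMaximallyMonotone A) {x : X} {f g : WeakDual ℝ X}
    (hf : f ∈ A x) (hg : g ∈ domNormalCone A x) : f + g ∈ A x := by
  refine hA.mem_of_forall fun y h hh => ?_
  have h1 := hA.1.apply_le hf hh
  have h2 := hg y ⟨h, hh⟩
  rw [weakDual_add_apply]
  linarith

/-- Scaling the monotonicity inequality for `(a n, f n)` by `t n` removes the other graph point in
the limit; the uniform boundedness principle controls the pairing of the weak* convergent
functionals with the norm convergent points. -/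
theorem IsMonotone.recCone_subset_domNormalCone [CompleteSpace X] (hA : IsMonotone A) (x : X) :
    recCone A x ⊆ domNormalCone A x := by
  rintro g ⟨t, a, f, ht, ht0, hf, ha, hg⟩ y ⟨h, hh⟩
  have hpt : ∀ v, Tendsto (fun n => (t n • f n) v) atTop (𝓝 (g v)) := fun v =>
    ((WeakDual.eval_continuous v).tendsto g).comp hg
  obtain ⟨C, hC⟩ : ∃ C, ∀ n, ‖WeakDual.toStrongDual (t n • f n)‖ ≤ C := by
    refine banach_steinhaus fun v => ?_
    obtain ⟨C, hC⟩ := (Metric.isBounded_range_of_tendsto _ (hpt v)).exists_norm_le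
    exact ⟨C, fun n => hC _ ⟨n, rfl⟩⟩
  have h1 : Tendsto (fun n => (t n • f n) (a n - x)) atTop (𝓝 0) := by
    have h2 : Tendsto (fun n => C * ‖a n - x‖) atTop (𝓝 0) := by
      simpa using (tendsto_iff_norm_sub_tendsto_zero.1 ha).const_mul C
    refine squeeze_zero_norm (fun n => ?_) h2
    exact ((WeakDual.toStrongDual (t n • f n)).le_opNorm _).trans
      (mul_le_mul_of_nonneg_right (hC n) (norm_nonneg _))
  have h2 : Tendsto (fun n => (t n • f n) (a n - x) + (t n • f n) (x - y)) atTop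
      (𝓝 (g (x - y))) := by
    simpa using h1.add (hpt (x - y))
  have h3 : Tendsto (fun n => t n * h (a n - y)) atTop (𝓝 0) := by
    have : Tendsto (fun n => h (a n - y)) atTop (𝓝 (h (x - y))) :=
      (h.continuous.tendsto _).comp (ha.sub_const y)
    simpa using ht0.mul this
  refine le_of_tendsto_of_tendsto' h3 h2 fun n => ?_
  have h4 := mul_le_mul_of_nonneg_left (hA.apply_le (hf n) hh) (ht n).le
  rw [← map_add, sub_add_sub_cancel, weakDual_smul_apply]
  exact h4

theorem IsMaximallyMonotone.domNormalCone_subset_recCone (hA : IsMaximallyMonotone A) {x : X}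
    (hx : x ∈ dom A) : domNormalCone A x ⊆ recCone A x := by
  obtain ⟨f, hf⟩ := hx
  intro g hg
  refine ⟨fun n : ℕ => 1 / ((n : ℝ) + 1), fun _ => x, fun n : ℕ => f + ((n : ℝ) + 1) • g,
    fun n => by positivity, tendsto_one_div_add_atTop_nhds_zero_nat,
    fun n => hA.add_mem hf (smul_mem_domNormalCone hg (by positivity)), tendsto_const_nhds, ?_⟩
  have h1 : Tendsto (fun n : ℕ => (1 / ((n : ℝ) + 1)) • f + g) atTop (𝓝 ((0 : ℝ) • f + g)) :=
    (tendsto_one_div_add_atTop_nhds_zero_nat.smul_const f).add_const g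
  rw [zero_smul, zero_add] at h1
  refine h1.congr fun n => ?_
  have : (n : ℝ) + 1 ≠ 0 := by positivity
  rw [smul_add, smul_smul, one_div_mul_cancel this, one_smul]

/-! ### Recovering the values from a dense subset of the interior of the domain -/

/-- In a direction `h` pointing into the interior of the domain, the functionals in `A s`, with
`s ∈ S` tending to `x` along `h`, stay bounded; a weak* cluster point lies in `hatOn A S x` and
dominates `f ∈ A x` at `h`. -/
theorem IsMaximallyMonotone.exists_mem_hatOn_le [CompleteSpace X] (hA : IsMaximallyMonotone A)
    {S : Set X} (hS : S ⊆ interior (dom A)) (hSd : interior (dom A) ⊆ closure S) {x h : X}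
    {f : WeakDual ℝ X} (hf : f ∈ A x) (hh : x + h ∈ interior (dom A)) :
    ∃ q ∈ hatOn A S x, f h ≤ q h := by
  obtain ⟨δ, hδ, K, hK, hco⟩ := hA.1.exists_coercive hh
  set F := WeakDual.toStrongDual f with hF
  set τ : ℕ → ℝ := fun n => 1 / ((n : ℝ) + 1) with hτ
  have hτ0 : ∀ n, 0 < τ n := fun n => by positivity
  have hτ1 : ∀ n, τ n ≤ 1 := fun n => by
    rw [hτ]
    exact div_le_one_of_le₀ (by linarith [n.cast_nonneg (α := ℝ)]) (by positivity)
  have hτlim : Tendsto τ atTop (𝓝 0) := tendsto_one_div_add_atTop_nhds_zero_nat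
  have hex : ∀ n, ∃ e, ‖e‖ ≤ τ n * (δ / 2) ∧ x + τ n • (h + e) ∈ S := by
    intro n
    have hp := hSd (hA.segment_subset_interior_dom hh ⟨f, hf⟩ (hτ0 n) (hτ1 n))
    obtain ⟨s, hs, hd⟩ := Metric.mem_closure_iff.1 hp (τ n * (τ n * (δ / 2)))
      (by have := hτ0 n; positivity)
    refine ⟨(τ n)⁻¹ • (s - ((1 - τ n) • x + τ n • (x + h))), ?_, ?_⟩
    · rw [norm_smul, norm_inv, Real.norm_of_nonneg (hτ0 n).le, inv_mul_le_iff₀ (hτ0 n)]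
      rw [dist_comm, dist_eq_norm] at hd
      exact hd.le
    · convert hs using 1
      rw [smul_add, smul_inv_smul₀ (hτ0 n).ne']
      module
  choose e he hes using hex
  have heδ : ∀ n, ‖e n‖ ≤ δ / 2 := fun n => (he n).trans
    (mul_le_of_le_one_left (by positivity) (hτ1 n))
  choose g hg using fun n => interior_subset (hS (hes n))
  have hmon : ∀ n, f (h + e n) ≤ g n (h + e n) := by
    intro n
    have h1 := hA.1.apply_le (hg n) hf
    rw [add_sub_cancel_left, map_smul, map_smul, smul_eq_mul, smul_eq_mul] at h1
    exact le_of_mul_le_mul_left h1 (hτ0 n)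
  have hfb : ∀ n, |f (h + e n)| ≤ ‖F‖ * (‖h‖ + δ) := fun n =>
    (F.le_opNorm _).trans (by
      gcongr
      exact (norm_add_le _ _).trans (by linarith [heδ n]))
  set B := ‖F‖ * (‖h‖ + δ) + K * (‖x‖ + (‖h‖ + δ) + 1) with hB
  have hgB : ∀ n, ‖WeakDual.toStrongDual (g n)‖ ≤ B / (δ / 2) := by
    intro n
    refine norm_toStrongDual_le (by positivity) fun v hv => ?_
    have h1 := hco _ _ (hg n) (v + e n) ((norm_add_le _ _).trans (by linarith [heδ n]))
    have h2 : x + τ n • (h + e n) - (x + h) = e n - (1 - τ n) • (h + e n) := by module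
    have h3 : K * (‖x + τ n • (h + e n)‖ + 1) ≤ K * (‖x‖ + (‖h‖ + δ) + 1) := by
      gcongr
      refine (norm_add_le _ _).trans ?_
      gcongr
      rw [norm_smul, Real.norm_of_nonneg (hτ0 n).le]
      refine (mul_le_of_le_one_left (norm_nonneg _) (hτ1 n)).trans ?_
      exact (norm_add_le _ _).trans (by linarith [heδ n])
    rw [h2, map_add, map_sub, map_smul, smul_eq_mul] at h1
    have h4 : -((1 - τ n) * g n (h + e n)) ≤ ‖F‖ * (‖h‖ + δ) := by
      have h5 := mul_le_mul_of_nonneg_left (hmon n) (sub_nonneg.2 (hτ1 n))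
      have h6 : -((1 - τ n) * f (h + e n)) ≤ |f (h + e n)| := by
        refine (neg_le_abs _).trans ?_
        rw [abs_mul, abs_of_nonneg (sub_nonneg.2 (hτ1 n))]
        exact mul_le_of_le_one_left (abs_nonneg _) (by linarith [hτ0 n])
      linarith [hfb n]
    linarith
  obtain ⟨q, -, hq⟩ := (WeakDual.isCompact_closedBall (𝕜 := ℝ) (0 : StrongDual ℝ X)
    (B / (δ / 2))).exists_mapClusterPt (f := atTop) (u := g)
    (tendsto_principal.2 (Eventually.of_forall fun n => by
      rw [mem_preimage, mem_closedBall_zero_iff]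
      exact hgB n))
  have hclosed : ∀ T : Set (WeakDual ℝ X), IsClosed T → (∀ᶠ n in atTop, g n ∈ T) → q ∈ T := by
    intro T hT hev
    exact hT.mem_of_mapClusterPt hq hev
  refine ⟨q, mem_iInter₂.2 fun ε hε => hclosed _ isClosed_closure ?_, ?_⟩
  · have hlim : Tendsto (fun n => x + τ n • (h + e n)) atTop (𝓝 x) := by
      rw [tendsto_iff_norm_sub_tendsto_zero]
      have h1 : Tendsto (fun n => τ n * (‖h‖ + δ)) atTop (𝓝 0) := by
        simpa using hτlim.mul_const (‖h‖ + δ)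
      refine squeeze_zero (fun _ => norm_nonneg _) (fun n => ?_) h1
      rw [add_sub_cancel_left, norm_smul, Real.norm_of_nonneg (hτ0 n).le]
      have := hτ0 n
      gcongr
      exact (norm_add_le _ _).trans (by linarith [heδ n])
    filter_upwards [hlim.eventually (Metric.closedBall_mem_nhds x hε)] with n hn
    exact subset_wstarClosedConvexHull _ (mem_image (C := S ∩ Metric.closedBall x ε) ⟨hes n, hn⟩ (hg n))
  · refine le_of_forall_pos_sub_le fun η hη => ?_
    refine hclosed {q | f h - η ≤ q h}
      (isClosed_le continuous_const (WeakDual.eval_continuous h)) ?_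
    have h1 : Tendsto (fun n => (‖F‖ + B / (δ / 2)) * (τ n * (δ / 2))) atTop (𝓝 0) := by
      simpa using (hτlim.mul_const (δ / 2)).const_mul (‖F‖ + B / (δ / 2))
    filter_upwards [h1.eventually (gt_mem_nhds hη)] with n hn
    have h2 := hmon n
    rw [map_add, map_add] at h2
    have h3 : -f (e n) ≤ ‖F‖ * (τ n * (δ / 2)) := (neg_le_abs _).trans
      ((F.le_opNorm _).trans (mul_le_mul_of_nonneg_left (he n) (norm_nonneg _)))
    have h4 : g n (e n) ≤ B / (δ / 2) * (τ n * (δ / 2)) := (le_abs_self _).trans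
      (((WeakDual.toStrongDual (g n)).le_opNorm _).trans
        (mul_le_mul (hgB n) (he n) (norm_nonneg _) ((norm_nonneg _).trans (hgB n))))
    change f h - η ≤ g n h
    linarith

/-- Both summands are coercive in the direction `x - z`, with `z` interior to the domain, so a
bounded part of the sum comes from norm bounded, hence weak* compact, parts of the summands. -/
theorem IsMonotone.isClosed_add_domNormalCone [CompleteSpace X] (hA : IsMonotone A)
    (hint : (interior (dom A)).Nonempty) {x : X} {Q : Set (WeakDual ℝ X)} (hQ : IsClosed Q)
    (hQA : Q ⊆ A x) : IsClosed (Q + domNormalCone A x) := by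
  obtain ⟨z, hz⟩ := hint
  obtain ⟨δ₁, hδ₁, K, hK, hco⟩ := hA.exists_coercive hz
  obtain ⟨δ₂, hδ₂, hball⟩ := Metric.mem_nhds_iff.1 (mem_interior_iff_mem_nhds.1 hz)
  set δ := min δ₁ (δ₂ / 2) with hδdef
  have hδ : 0 < δ := by positivity
  refine closure_subset_iff_isClosed.1 fun f hf => ?_
  set c := f (x - z) + 1 with hc
  set C := K * (‖x‖ + 1) with hC
  have hC0 : 0 ≤ C := by positivity
  set W : Set (WeakDual ℝ X) := WeakDual.toStrongDual ⁻¹' Metric.closedBall 0 ((c + C) / δ) with hW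
  have hWc : IsCompact W := WeakDual.isCompact_closedBall _ _
  have hmemW : ∀ g : WeakDual ℝ X, (∀ v, ‖v‖ ≤ δ → g v ≤ c + C) → g ∈ W := fun g hg => by
    rw [hW, mem_preimage, mem_closedBall_zero_iff]
    exact norm_toStrongDual_le hδ hg
  have hsub : (Q + domNormalCone A x) ∩ {u | u (x - z) < c} ⊆ (Q ∩ W) + (domNormalCone A x ∩ W) := by
    rintro _ ⟨⟨q, hq, g, hg, rfl⟩, hu⟩
    simp only [mem_ofPred_eq, weakDual_add_apply] at hu
    have h1 : ∀ v, ‖v‖ ≤ δ → q v ≤ q (x - z) + C := fun v hv =>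
      hco x q (hQA hq) v (hv.trans (min_le_left _ _))
    have h2 : ∀ v, ‖v‖ ≤ δ → g v ≤ g (x - z) := fun v hv => by
      have := hg (z + v) (hball (by
        rw [mem_ball_iff_norm, add_sub_cancel_left]
        linarith [hv.trans (min_le_right δ₁ (δ₂ / 2))]))
      simp only [map_sub, map_add] at this ⊢
      linarith
    have h3 := h1 0 (by simpa using hδ.le)
    have h4 := h2 0 (by simpa using hδ.le)
    rw [map_zero] at h3 h4
    exact ⟨q, ⟨hq, hmemW q fun v hv => (h1 v hv).trans (by linarith)⟩, g,
      ⟨hg, hmemW g fun v hv => (h2 v hv).trans (by linarith)⟩, rfl⟩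
  have hcl : IsClosed ((Q ∩ W) + (domNormalCone A x ∩ W)) :=
    ((hWc.inter_left hQ).add (hWc.inter_left (isClosed_domNormalCone x))).isClosed
  have hopen : IsOpen {u : WeakDual ℝ X | u (x - z) < c} :=
    isOpen_lt (WeakDual.eval_continuous (x - z)) continuous_const
  have hfu : f ∈ {u : WeakDual ℝ X | u (x - z) < c} := by
    simp only [mem_ofPred_eq]
    linarith
  have hmem := closure_minimal hsub hcl
    (by
      rw [inter_comm]
      exact hopen.inter_closure ⟨hfu, hf⟩)
  exact add_subset_add inter_subset_left inter_subset_left hmem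

/-- A direction on which the normal cone to the domain is nonpositive points into the interior of
the domain after an arbitrarily small tilt towards an interior point. -/
theorem IsMaximallyMonotone.exists_add_smul_mem_interior_dom [CompleteSpace X]
    (hA : IsMaximallyMonotone A) {x z h : X} (hz : z ∈ interior (dom A))
    (hh : ∀ g ∈ domNormalCone A x, g h ≤ 0) {ε : ℝ} (hε : 0 < ε) :
    ∃ t : ℝ, 0 < t ∧ x + t • (h + ε • (z - x)) ∈ interior (dom A) := by
  by_contra! hcon
  set h' := h + ε • (z - x) with hh'
  have hR : Convex ℝ ((fun t : ℝ => x + t • h') '' Ioi 0) := by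
    rintro _ ⟨t, ht, rfl⟩ _ ⟨t', ht', rfl⟩ a b ha hb hab
    refine ⟨a • t + b • t', convex_Ioi 0 ht ht' ha hb hab, ?_⟩
    obtain rfl : b = 1 - a := by linarith
    simp only [smul_eq_mul]
    module
  obtain ⟨φ, u, h1, h2⟩ := geometric_hahn_banach_open hA.convex_interior_dom isOpen_interior hR
    (Set.disjoint_left.2 (by rintro _ hp ⟨t, ht, rfl⟩; exact hcon t ht hp))
  have h3 : ∀ t > 0, u ≤ φ x + t * φ h' := fun t ht => by
    simpa using h2 _ ⟨t, ht, rfl⟩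
  have h4 : u ≤ φ x := by
    have hlim : Tendsto (fun t : ℝ => φ x + t * φ h') (𝓝[>] 0) (𝓝 (φ x)) := by
      have : Continuous fun t : ℝ => φ x + t * φ h' := by fun_prop
      simpa using (this.tendsto 0).mono_left nhdsWithin_le_nhds
    exact ge_of_tendsto hlim (eventually_nhdsWithin_of_forall h3)
  have h5 : 0 ≤ φ h' := by
    by_contra! h5
    have h6 := h3 ((φ x - u + 1) / (-φ h')) (div_pos (by linarith) (by linarith))
    have h7 : (φ x - u + 1) / (-φ h') * φ h' = -(φ x - u + 1) := by
      have := h5.ne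
      field_simp
    linarith
  have h6 : StrongDual.toWeakDual φ ∈ domNormalCone A x := by
    intro y hy
    rw [StrongDual.toWeakDual_apply]
    have hlim : Tendsto (fun t : ℝ => φ ((1 - t) • y + t • z)) (𝓝[>] 0) (𝓝 (φ y)) := by
      have : Continuous fun t : ℝ => φ ((1 - t) • y + t • z) := by fun_prop
      simpa using (this.tendsto 0).mono_left nhdsWithin_le_nhds
    have h7 : φ y ≤ u := by
      refine le_of_tendsto hlim ?_
      filter_upwards [Ioc_mem_nhdsGT zero_lt_one] with t ht
      exact (h1 _ (hA.segment_subset_interior_dom hz hy ht.1 ht.2)).le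
    rw [map_sub]
    linarith
  have h7 := hh _ h6
  have h8 := h1 z hz
  rw [StrongDual.toWeakDual_apply] at h7
  have h9 : φ h' = φ h + ε * (φ z - φ x) := by simp [hh']
  have h10 : ε * (φ z - φ x) < 0 := mul_neg_of_pos_of_neg hε (by linarith)
  linarith

instance instLocallyConvexSpaceWeakDual : LocallyConvexSpace ℝ (WeakDual ℝ X) :=
  inferInstanceAs (LocallyConvexSpace ℝ (WeakBilin (topDualPairing ℝ X)))

theorem exists_eq_eval_of_weakDual (φ : StrongDual ℝ (WeakDual ℝ X)) :
    ∃ h : X, ∀ g : WeakDual ℝ X, φ g = g h := by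
  obtain ⟨h, hh⟩ := LinearMap.dualEmbedding_surjective (topDualPairing ℝ X) φ
  exact ⟨h, fun g => by rw [← hh]; rfl⟩

/-- A point of `A x` outside the closed convex set `hatOn A S x + domNormalCone A x` would be
strictly separated from it by some `h`. The normal cone is nonpositive at `h`, so `h` can be
tilted into the interior of the domain without destroying the separation, which contradicts
`exists_mem_hatOn_le`. -/
theorem IsMaximallyMonotone.subset_hatOn_add [CompleteSpace X] (hA : IsMaximallyMonotone A)
    (hint : (interior (dom A)).Nonempty) {S : Set X} (hS : S ⊆ interior (dom A))
    (hSd : interior (dom A) ⊆ closure S) (x : X) :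
    A x ⊆ hatOn A S x + domNormalCone A x := by
  intro f hf
  by_contra hfn
  have hQA : hatOn A S x ⊆ A x := (hatOn_subset_hat S x).trans (hA.hat_subset hint x)
  obtain ⟨φ, u, h1, h2⟩ := geometric_hahn_banach_closed_point
    ((convex_hatOn S x).add (convex_domNormalCone x))
    (hA.1.isClosed_add_domNormalCone hint (isClosed_hatOn S x) hQA) hfn
  obtain ⟨h, hφ⟩ := exists_eq_eval_of_weakDual φ
  simp only [hφ] at h1 h2
  obtain ⟨z, hz⟩ := hint
  obtain ⟨k, hk⟩ := interior_subset hz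
  have hsep : ∀ q ∈ hatOn A S x, ∀ g ∈ domNormalCone A x, q h + g h < u := fun q hq g hg =>
    h1 _ (add_mem_add hq hg)
  obtain ⟨q₀, hq₀, -⟩ := hA.exists_mem_hatOn_le hS hSd hf (h := z - x) (by simpa using hz)
  have hN : ∀ g ∈ domNormalCone A x, g h ≤ 0 := by
    intro g hg
    by_contra! hgh
    have h3 := hsep q₀ hq₀ _ (smul_mem_domNormalCone hg
      (c := |u - q₀ h| / g h) (by positivity))
    rw [weakDual_smul_apply, div_mul_cancel₀ _ hgh.ne'] at h3
    linarith [le_abs_self (u - q₀ h)]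
  set D := k (z - x) - f (z - x) with hD
  set ε := (f h - u) / (2 * (|D| + 1)) with hε
  have hε0 : 0 < ε := div_pos (by linarith) (by positivity)
  have hεD : ε * D ≤ (f h - u) / 2 := by
    rw [hε, div_mul_eq_mul_div, div_le_iff₀ (by positivity)]
    have : (f h - u) * D ≤ (f h - u) * (|D| + 1) :=
      mul_le_mul_of_nonneg_left (by linarith [le_abs_self D]) (by linarith)
    linarith
  obtain ⟨t, ht, hmem⟩ := hA.exists_add_smul_mem_interior_dom hz hN hε0
  obtain ⟨q, hq, hfq⟩ := hA.exists_mem_hatOn_le hS hSd hf hmem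
  have h3 : f (h + ε • (z - x)) ≤ q (h + ε • (z - x)) := by
    rw [map_smul, map_smul, smul_eq_mul, smul_eq_mul] at hfq
    exact le_of_mul_le_mul_left hfq ht
  have h4 := hsep q hq 0 (fun y _ => le_rfl)
  have h5 := hA.1.apply_le hk (hQA hq)
  have h6 : (0 : WeakDual ℝ X) h = 0 := rfl
  rw [map_add, map_add, map_smul, map_smul, smul_eq_mul, smul_eq_mul] at h3
  have h7 := mul_le_mul_of_nonneg_left h5 hε0.le
  have h8 : ε * D = ε * k (z - x) - ε * f (z - x) := by rw [hD, mul_sub]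
  linarith

theorem IsMaximallyMonotone.eq_hatOn_add_recCone [CompleteSpace X] (hA : IsMaximallyMonotone A)
    (hint : (interior (dom A)).Nonempty) {S : Set X} (hS : S ⊆ interior (dom A))
    (hSd : interior (dom A) ⊆ closure S) (x : X) :
    A x = hatOn A S x + recCone A x := by
  refine Subset.antisymm (fun f hf => ?_) ?_
  · exact add_subset_add_left (hA.domNormalCone_subset_recCone ⟨f, hf⟩)
      (hA.subset_hatOn_add hint hS hSd x hf)
  · rintro _ ⟨q, hq, g, hg, rfl⟩
    exact hA.add_mem (hA.hat_subset hint x (hatOn_subset_hat S x hq))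
      (hA.1.recCone_subset_domNormalCone x hg)

end MonotoneOperator

theorem mainTheorem2 {X : Type u} [NormedAddCommGroup X] [NormedSpace ℝ X]
    [CompleteSpace X] (A : X → Set (WeakDual ℝ X))
    (hA : MonotoneOperator.IsMaximallyMonotone A)
    (hint : (interior (MonotoneOperator.dom A)).Nonempty) :
    MonotoneOperator.hat A = A ∧
    MonotoneOperator.HasPropertyQ.{u, w} A ∧
    IsClosed (MonotoneOperator.gra A) ∧
    ∀ S : Set X, S ⊆ interior (MonotoneOperator.dom A) →
      interior (MonotoneOperator.dom A) ⊆ closure S →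
      ∀ x : X,
        MonotoneOperator.wstarClosedConvexHull (MonotoneOperator.closureOn A S x) ⊆
          MonotoneOperator.hatOn A S x ∧
        A x = MonotoneOperator.hatOn A S x + MonotoneOperator.recCone A x := by
  have hsub := hA.hat_subset hint
  exact ⟨hA.hat_eq hint, MonotoneOperator.hasPropertyQ_of_hat_subset hsub,
    MonotoneOperator.isClosed_gra_of_hat_subset hsub, fun S hS hSd x =>
      ⟨MonotoneOperator.wstarClosedConvexHull_closureOn_subset S x,
        hA.eq_hatOn_add_recCone hint hS hSd x⟩⟩
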